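/- Let $M_1, M_2$ be smooth finite-dimensional manifolds without boundary, $M_2$ nonempty, and put $m_2=\dim M_2$. Let $0<\bar T\le\infty$. For $t\in[0,\bar T)$ let $g_1(t)$ and $g_2(t)$ be smooth Riemannian metrics on $M_1$ and $M_2$, and let $\lambda(\cdot,t)$ be a smooth positive function on $M_1$. Suppose that the warped product metrics $$\bar g(t)=g_1(t)\oplus\lambda^2(\cdot,t)\,g_2(t)=\pi_1^*g_1(t)+(\lambda(\cdot,t)\circ\pi_1)^2\,\pi_2^*g_2(t)$$ on $M_1\times M_2$, with $\pi_1,\pi_2$ the two projections, solve the Ricci flow $\partial_t\bar g=-2\,\overline{\mathrm{Ric}}$ on $[0,\bar T)$, where $\overline{\mathrm{Ric}}$ is the Ricci tensor of $\bar g(t)$ and the time derivative at $t=0$ is one-sided. Denote by ${}^{M_i}\mathrm{Ric}$ the Ricci tensor of $g_i(t)$ and by $\mathrm{Hess}$, $\Delta=\mathrm{tr}_{g_1}\mathrm{Hess}$, $\mathrm{grad}$ and $|\cdot|$ the Hessian, Laplacian, gradient and norm of $(M_1,g_1(t))$. Then for all $t\in[0,\bar T)$: 1. on $M_1$, $$\frac{\partial}{\partial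 t}g_1=-2\,{}^{M_1}\mathrm{Ric}+\frac{2m_2}{\lambda}\,\mathrm{Hess}(\lambda);$$ 2. at every $(x,y)\in M_1\times M_2$, as bilinear forms on $T_yM_2$, $$\frac{\partial}{\partial t}\left(\lambda^2g_2\right)=-2\,{}^{M_2}\mathrm{Ric}+\left(\Delta\lambda^2+(2m_2-4)\,|\mathrm{grad}\,\lambda|^2\right)g_2;$$ 3. if moreover $m_2\ge1$, $g_2$ does not depend on $t$, and $g_2$ is Einstein with ${}^{M_2}\mathrm{Ric}=c\,g_2$ for a constant $c\in\mathbb R$, then on $M_1$ $$\frac{\partial}{\partial t}\lambda^2=-2c+\Delta\lambda^2+(2m_2-4)\,|\mathrm{grad}\,\lambda|^2 .$$ In each case the existence of the time derivative is part of the assertion. -/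

import Mathlib

open Set Manifold Topology
open scoped ContDiff

set_option maxSynthPendingDepth 3
set_option linter.unusedSectionVars false

noncomputable section

namespace WarpedFlow

/-! ### Pull-back of bilinear forms -/

section Bilinear

variable {V W : Type*} [AddCommGroup V] [Module ℝ V] [TopologicalSpace V]
  [IsTopologicalAddGroup V] [ContinuousSMul ℝ V]
  [AddCommGroup W] [Module ℝ W] [TopologicalSpace W]
  [IsTopologicalAddGroup W] [ContinuousSMul ℝ W]

/-- The pull-back `(v, w) ↦ B (A v) (A w)` of a bilinear form `B` by a linear map `A`. -/
def pullbackForm (B : W →L[ℝ] W →L[ℝ] ℝ) (A : V →L[ℝ] W) : V →L[ℝ] V →L[ℝ] ℝ :=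
  (ContinuousLinearMap.precomp ℝ A) ∘L (B ∘L A)

@[simp] theorem pullbackForm_apply (B : W →L[ℝ] W →L[ℝ] ℝ) (A : V →L[ℝ] W) (v w : V) :
    pullbackForm B A v w = B (A v) (A w) := rfl

end Bilinear

/-! ### Riemannian geometry of a metric `G` on (an open subset of) a vector space `E` -/

section Local

variable {E : Type*} [NormedAddCommGroup E] [NormedSpace ℝ E]

/-- Christoffel symbols of the first kind:
`K(v, w)(z) = (∂_v G(w, z) + ∂_w G(v, z) - ∂_z G(v, w)) / 2`. -/
def chartKoszul (G : E → E →L[ℝ] E →L[ℝ] ℝ) (u : E) : E →L[ℝ] E →L[ℝ] E →L[ℝ] ℝ :=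
  (1 / 2 : ℝ) • (fderiv ℝ G u + (fderiv ℝ G u).flip
    - ContinuousLinearMap.comp
        ((ContinuousLinearMap.flipₗᵢ ℝ E E ℝ).toContinuousLinearEquiv :
          (E →L[ℝ] E →L[ℝ] ℝ) →L[ℝ] (E →L[ℝ] E →L[ℝ] ℝ)) (fderiv ℝ G u).flip)

theorem chartKoszul_apply (G : E → E →L[ℝ] E →L[ℝ] ℝ) (u v w z : E) :
    chartKoszul G u v w z =
      (fderiv ℝ G u v w z + fderiv ℝ G u w v z - fderiv ℝ G u z v w) / 2 := by
  simp [chartKoszul]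
  ring

/-- Christoffel symbols `Γ(v, w)` of the Levi-Civita connection, determined by
`G(Γ(v, w), z) = K(v, w)(z)`; in coordinates, `Γ(∂_i, ∂_j) = Γ^k_{ij} ∂_k`. -/
def chartChristoffel (G : E → E →L[ℝ] E →L[ℝ] ℝ) (u : E) : E →L[ℝ] E →L[ℝ] E :=
  (ContinuousLinearMap.compL ℝ E (E →L[ℝ] ℝ) E (G u).inverse) ∘L (chartKoszul G u)

theorem chartChristoffel_apply (G : E → E →L[ℝ] E →L[ℝ] ℝ) (u v w : E) :
    chartChristoffel G u v w = (G u).inverse (chartKoszul G u v w) := rfl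

/-- For fixed `w, z`, the endomorphism `v ↦ R(v, w) z`, where `R` is the curvature tensor
`R(X, Y) Z = ∇_X ∇_Y Z - ∇_Y ∇_X Z - ∇_{[X, Y]} Z`. -/
def chartCurvature (G : E → E →L[ℝ] E →L[ℝ] ℝ) (u w z : E) : E →L[ℝ] E :=
  ((fderiv ℝ (chartChristoffel G) u).flip w).flip z
    - (fderiv ℝ (chartChristoffel G) u w).flip z
    + (chartChristoffel G u).flip (chartChristoffel G u w z)
    - (chartChristoffel G u w) ∘L (chartChristoffel G u).flip z

theorem chartCurvature_apply (G : E → E →L[ℝ] E →L[ℝ] ℝ) (u w z v : E) :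
    chartCurvature G u w z v =
      fderiv ℝ (chartChristoffel G) u v w z - fderiv ℝ (chartChristoffel G) u w v z
        + chartChristoffel G u v (chartChristoffel G u w z)
        - chartChristoffel G u w (chartChristoffel G u v z) := by
  simp [chartCurvature]

/-- The Ricci tensor `Ric(w, z) = trace (v ↦ R(v, w) z)`. -/
def chartRicci (G : E → E →L[ℝ] E →L[ℝ] ℝ) (u w z : E) : ℝ :=
  LinearMap.trace ℝ E (chartCurvature G u w z : E →ₗ[ℝ] E)

/-- The Hessian `Hess f (v, w) = ∂_v ∂_w f - df(Γ(v, w))`. -/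
def chartHessian (G : E → E →L[ℝ] E →L[ℝ] ℝ) (f : E → ℝ) (u : E) : E →L[ℝ] E →L[ℝ] ℝ :=
  fderiv ℝ (fderiv ℝ f) u
    - (ContinuousLinearMap.compL ℝ E E ℝ (fderiv ℝ f u)) ∘L (chartChristoffel G u)

theorem chartHessian_apply (G : E → E →L[ℝ] E →L[ℝ] ℝ) (f : E → ℝ) (u v w : E) :
    chartHessian G f u v w =
      fderiv ℝ (fderiv ℝ f) u v w - fderiv ℝ f u (chartChristoffel G u v w) := by
  simp [chartHessian]

end Local

/-! ### Riemannian geometry on a manifold -/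

section Global

variable {E : Type*} [NormedAddCommGroup E] [NormedSpace ℝ E]
  {H : Type*} [TopologicalSpace H] (I : ModelWithCorners ℝ E H)
  (M : Type*) [TopologicalSpace M] [ChartedSpace H M] [IsManifold I ∞ M]

/-- Smooth Riemannian metrics on the manifold `M`. -/
abbrev RiemMetric : Type _ :=
  Bundle.ContMDiffRiemannianMetric I ∞ E (fun x : M => TangentSpace I x)

variable {I M}

/-- The expression of the metric `g` in the chart around `x₀`, i.e. its pull-back by the inverse
of the chart; in coordinates, `(v, w) ↦ g_{ij} v^i w^j`. -/
def chartMetric (g : RiemMetric I M) (x₀ : M) (u : E) : E →L[ℝ] E →L[ℝ] ℝ :=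
  pullbackForm (V := E) (g.inner ((extChartAt I x₀).symm u))
    (mfderivWithin 𝓘(ℝ, E) I (extChartAt I x₀).symm (range I) u)

/-- The coordinates of a bilinear form in the standard local trivialization. -/
theorem trivialization_form_apply (x₀ x : M) (hx : x ∈ (chartAt H x₀).source)
    (B : TangentSpace I x →L[ℝ] TangentSpace I x →L[ℝ] ℝ) (v w : E) :
    (trivializationAt (E →L[ℝ] E →L[ℝ] ℝ)
      (fun y : M => TangentSpace I y →L[ℝ] TangentSpace I y →L[ℝ] ℝ) x₀ ⟨x, B⟩).2 v w =
      B ((trivializationAt E (TangentSpace I) x₀).symmL ℝ x v)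
        ((trivializationAt E (TangentSpace I) x₀).symmL ℝ x w) := by
  have hx' : x ∈ (trivializationAt (E →L[ℝ] ℝ)
      (fun y : M => TangentSpace I y →L[ℝ] ℝ) x₀).baseSet := by
    simpa [hom_trivializationAt_baseSet] using hx
  rw [hom_trivializationAt_apply]
  simp only [ContinuousLinearMap.inCoordinates, ContinuousLinearMap.comp_apply]
  rw [Bundle.Trivialization.continuousLinearMapAt_apply,
    Bundle.Trivialization.coe_linearMapAt_of_mem _ hx']
  beta_reduce
  rw [hom_trivializationAt_apply]
  simp [ContinuousLinearMap.inCoordinates]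

/-- The Ricci tensor of `g` at `x`, computed in the chart around `x`. -/
def ricci (g : RiemMetric I M) (x : M) (v w : TangentSpace I x) : ℝ :=
  chartRicci (chartMetric g x) (extChartAt I x x)
    (mfderiv I 𝓘(ℝ, E) (extChartAt I x) x v) (mfderiv I 𝓘(ℝ, E) (extChartAt I x) x w)

/-- The Hessian of `f` at `x` with respect to `g`, computed in the chart around `x`. -/
def hessian (g : RiemMetric I M) (f : M → ℝ) (x : M) :
    TangentSpace I x →L[ℝ] TangentSpace I x →L[ℝ] ℝ :=
  pullbackForm (W := E)
    (chartHessian (chartMetric g x) (f ∘ (extChartAt I x).symm) (extChartAt I x x))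
    (mfderiv I 𝓘(ℝ, E) (extChartAt I x) x)

/-- The Laplacian `Δ f`, the trace of the Hessian of `f` with respect to `g`. -/
def laplacian (g : RiemMetric I M) (f : M → ℝ) (x : M) : ℝ :=
  LinearMap.trace ℝ (TangentSpace I x)
    ((g.inner x).inverse ∘L (hessian g f x) : TangentSpace I x →L[ℝ] TangentSpace I x).toLinearMap

/-- The gradient of `f`, determined by `g(grad f, w) = df(w)`. -/
def grad (g : RiemMetric I M) (f : M → ℝ) (x : M) : TangentSpace I x :=
  (g.inner x).inverse (mfderiv I 𝓘(ℝ, ℝ) f x : TangentSpace I x →L[ℝ] ℝ)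

/-- The squared norm `|grad f|²` of the gradient. -/
def gradNormSq (g : RiemMetric I M) (f : M → ℝ) (x : M) : ℝ :=
  g.inner x (grad g f x) (grad g f x)

/-- The time interval `[0, T)`, where `T` may be `∞`. -/
def timeInterval (T : EReal) : Set ℝ := {t | 0 ≤ t ∧ (t : EReal) < T}

/-- The family `g` of Riemannian metrics solves the Ricci flow `∂g/∂t = -2 Ric` on `[0, T)`
(at `t = 0` the derivative is one-sided). The values of `g` at times outside `[0, T)` play no
role. -/
def IsRicciFlow (g : ℝ → RiemMetric I M) (T : EReal) : Prop :=
  ∀ t ∈ timeInterval T, ∀ (x : M) (v w : TangentSpace I x),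
    HasDerivWithinAt (fun s => (g s).inner x v w) (-2 * ricci (g t) x v w) (timeInterval T) t

end Global

/-! ### Warped products -/

section Warped

variable {E₁ : Type*} [NormedAddCommGroup E₁] [NormedSpace ℝ E₁]
  {H₁ : Type*} [TopologicalSpace H₁] {I₁ : ModelWithCorners ℝ E₁ H₁}
  {M₁ : Type*} [TopologicalSpace M₁] [ChartedSpace H₁ M₁] [IsManifold I₁ ∞ M₁]
  {E₂ : Type*} [NormedAddCommGroup E₂] [NormedSpace ℝ E₂]
  {H₂ : Type*} [TopologicalSpace H₂] {I₂ : ModelWithCorners ℝ E₂ H₂}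
  {M₂ : Type*} [TopologicalSpace M₂] [ChartedSpace H₂ M₂] [IsManifold I₂ ∞ M₂]

/-- The bilinear form `g₁(dπ₁ X, dπ₁ Y) + lam² g₂(dπ₂ X, dπ₂ Y)` on `T_p(M₁ × M₂)`. -/
def warpedForm (g₁ : RiemMetric I₁ M₁) (g₂ : RiemMetric I₂ M₂) (lam : M₁ → ℝ) (p : M₁ × M₂) :
    TangentSpace (I₁.prod I₂) p →L[ℝ] TangentSpace (I₁.prod I₂) p →L[ℝ] ℝ :=
  pullbackForm (g₁.inner p.1) (mfderiv (I₁.prod I₂) I₁ Prod.fst p)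
    + (lam p.1) ^ 2 • pullbackForm (g₂.inner p.2) (mfderiv (I₁.prod I₂) I₂ Prod.snd p)

theorem warpedForm_apply (g₁ : RiemMetric I₁ M₁) (g₂ : RiemMetric I₂ M₂) (lam : M₁ → ℝ)
    (p : M₁ × M₂) (X Y : TangentSpace (I₁.prod I₂) p) :
    warpedForm g₁ g₂ lam p X Y =
      g₁.inner p.1 (mfderiv (I₁.prod I₂) I₁ Prod.fst p X) (mfderiv (I₁.prod I₂) I₁ Prod.fst p Y)
      + (lam p.1) ^ 2 * g₂.inner p.2 (mfderiv (I₁.prod I₂) I₂ Prod.snd p X)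
          (mfderiv (I₁.prod I₂) I₂ Prod.snd p Y) := rfl

theorem isVonNBounded_of_pos {E : Type*} [NormedAddCommGroup E] [NormedSpace ℝ E]
    [FiniteDimensional ℝ E] (B : E →L[ℝ] E →L[ℝ] ℝ) (pos : ∀ v, v ≠ 0 → 0 < B v v) :
    Bornology.IsVonNBounded ℝ {v : E | B v v < 1} := by
  rw [NormedSpace.isVonNBounded_iff]
  have hK : IsCompact (Metric.sphere (0 : E) 1) := isCompact_sphere 0 1
  have hc : ContinuousOn (fun v : E => B v v) (Metric.sphere (0 : E) 1) := by fun_prop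
  obtain ⟨c, hc0, hcB⟩ : ∃ c : ℝ, 0 < c ∧ ∀ v ∈ Metric.sphere (0 : E) 1, c ≤ B v v := by
    rcases (Metric.sphere (0 : E) 1).eq_empty_or_nonempty with h | h
    · exact ⟨1, one_pos, by simp [h]⟩
    · obtain ⟨v, hv, hmin⟩ := hK.exists_isMinOn h hc
      refine ⟨B v v, pos v ?_, fun w hw => hmin hw⟩
      rintro rfl
      simp at hv
  refine (Metric.isBounded_closedBall (x := (0 : E)) (r := max 1 (1 / c))).subset ?_
  intro v hv
  simp only [mem_ofPred_eq] at hv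
  rw [mem_closedBall_zero_iff]
  by_contra! hlt
  have h1 : 1 < ‖v‖ := lt_of_le_of_lt (le_max_left _ _) hlt
  have h2 : 1 / c < ‖v‖ := lt_of_le_of_lt (le_max_right _ _) hlt
  have hn : 0 < ‖v‖ := by linarith
  have h3 := hcB (‖v‖⁻¹ • v) (by simp [norm_smul, hn.ne'])
  simp only [map_smul, smul_apply, smul_eq_mul] at h3
  have h4 : c * (‖v‖ * ‖v‖) ≤ B v v := by
    have := mul_le_mul_of_nonneg_right h3 (mul_pos hn hn).le
    field_simp at this
    nlinarith
  rw [div_lt_iff₀ hc0] at h2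
  nlinarith

theorem warpedForm_pos (g₁ : RiemMetric I₁ M₁) (g₂ : RiemMetric I₂ M₂) (lam : M₁ → ℝ)
    (hpos : ∀ x, 0 < lam x) (p : M₁ × M₂) (X : TangentSpace (I₁.prod I₂) p) (hX : X ≠ 0) :
    0 < warpedForm g₁ g₂ lam p X X := by
  rw [warpedForm_apply, mfderiv_fst, mfderiv_snd]
  have hl : 0 < lam p.1 ^ 2 := pow_pos (hpos _) 2
  have h1 : ∀ v : TangentSpace I₁ p.1, 0 ≤ g₁.inner p.1 v v := fun v => by
    rcases eq_or_ne v 0 with rfl | h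
    · simp
    · exact (g₁.pos _ _ h).le
  have h2 : ∀ v : TangentSpace I₂ p.2, 0 ≤ g₂.inner p.2 v v := fun v => by
    rcases eq_or_ne v 0 with rfl | h
    · simp
    · exact (g₂.pos _ _ h).le
  change 0 < g₁.inner p.1 (X : E₁ × E₂).1 (X : E₁ × E₂).1
    + lam p.1 ^ 2 * g₂.inner p.2 (X : E₁ × E₂).2 (X : E₁ × E₂).2
  by_cases hX1 : (X : E₁ × E₂).1 = 0
  · have hX2 : (X : E₁ × E₂).2 ≠ 0 := fun h => hX (Prod.ext hX1 h)
    have := mul_pos hl (g₂.pos p.2 _ hX2)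
    linarith [h1 (X : E₁ × E₂).1]
  · have := g₁.pos p.1 _ hX1
    linarith [mul_nonneg hl.le (h2 (X : E₁ × E₂).2)]

theorem hasFDerivWithinAt_prod_map {E F E' F' : Type*} [NormedAddCommGroup E] [NormedSpace ℝ E]
    [NormedAddCommGroup F] [NormedSpace ℝ F] [NormedAddCommGroup E'] [NormedSpace ℝ E']
    [NormedAddCommGroup F'] [NormedSpace ℝ F'] {f : E → E'} {g : F → F'} {f' : E →L[ℝ] E'}
    {g' : F →L[ℝ] F'} {s : Set E} {t : Set F} {x : E} {y : F} (hf : HasFDerivWithinAt f f' s x)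
    (hg : HasFDerivWithinAt g g' t y) :
    HasFDerivWithinAt (Prod.map f g) (f'.prodMap g') (s ×ˢ t) (x, y) :=
  HasFDerivWithinAt.prodMap (p := (x, y)) (hf.mono (by grind)) (hg.mono (by grind))

theorem tangentCoordChange_prod (p₀ p : M₁ × M₂) (hp : p ∈ (chartAt (ModelProd H₁ H₂) p₀).source) :
    tangentCoordChange (I₁.prod I₂) p₀ p p =
      (tangentCoordChange I₁ p₀.1 p.1 p.1).prodMap (tangentCoordChange I₂ p₀.2 p.2 p.2) := by
  have d₁ := hasFDerivWithinAt_tangentCoordChange (I := I₁) (x := p₀.1) (y := p.1) (z := p.1)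
    ⟨by rw [extChartAt_source]; exact hp.1, mem_extChartAt_source p.1⟩
  have d₂ := hasFDerivWithinAt_tangentCoordChange (I := I₂) (x := p₀.2) (y := p.2) (z := p.2)
    ⟨by rw [extChartAt_source]; exact hp.2, mem_extChartAt_source p.2⟩
  have d := hasFDerivWithinAt_tangentCoordChange (I := I₁.prod I₂) (x := p₀) (y := p) (z := p)
    ⟨by rw [extChartAt_source]; exact hp, mem_extChartAt_source p⟩
  have hd := hasFDerivWithinAt_prod_map d₁ d₂
  have hf : (extChartAt (I₁.prod I₂) p ∘ (extChartAt (I₁.prod I₂) p₀).symm : E₁ × E₂ → E₁ × E₂) =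
      Prod.map (extChartAt I₁ p.1 ∘ (extChartAt I₁ p₀.1).symm)
        (extChartAt I₂ p.2 ∘ (extChartAt I₂ p₀.2).symm) := by
    rw [extChartAt_prod, extChartAt_prod]; rfl
  have hx : extChartAt (I₁.prod I₂) p₀ p = (extChartAt I₁ p₀.1 p.1, extChartAt I₂ p₀.2 p.2) := by
    rw [extChartAt_prod]; rfl
  have hu : UniqueDiffWithinAt ℝ (range I₁ ×ˢ range I₂)
      (extChartAt I₁ p₀.1 p.1, extChartAt I₂ p₀.2 p.2) :=
    (I₁.uniqueDiffOn _ (mem_range_self _)).prod (I₂.uniqueDiffOn _ (mem_range_self _))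
  rw [hf, hx, ModelWithCorners.range_prod] at d
  exact hu.eq d hd

theorem symmL_trivializationAt_apply {E : Type*} [NormedAddCommGroup E] [NormedSpace ℝ E]
    {H : Type*} [TopologicalSpace H] {I : ModelWithCorners ℝ E H}
    {M : Type*} [TopologicalSpace M] [ChartedSpace H M] [IsManifold I ∞ M] (x₀ x : M)
    (hx : x ∈ (chartAt H x₀).source) (v : E) :
    ((trivializationAt E (TangentSpace I) x₀).symmL ℝ x v : E) = tangentCoordChange I x₀ x x v :=
  DFunLike.congr_fun (TangentBundle.symmL_trivializationAt_eq_core hx) v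

theorem symmL_trivializationAt_prod (p₀ p : M₁ × M₂)
    (hp : p ∈ (chartAt (ModelProd H₁ H₂) p₀).source) (v : E₁ × E₂) :
    ((trivializationAt (E₁ × E₂) (TangentSpace (I₁.prod I₂)) p₀).symmL ℝ p v : E₁ × E₂) =
      ((trivializationAt E₁ (TangentSpace I₁) p₀.1).symmL ℝ p.1 v.1,
        (trivializationAt E₂ (TangentSpace I₂) p₀.2).symmL ℝ p.2 v.2) :=
  (symmL_trivializationAt_apply (I := I₁.prod I₂) p₀ p hp v).trans
    ((DFunLike.congr_fun (tangentCoordChange_prod p₀ p hp) v).trans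
      (Prod.ext (symmL_trivializationAt_apply (I := I₁) p₀.1 p.1 hp.1 v.1).symm
        (symmL_trivializationAt_apply (I := I₂) p₀.2 p.2 hp.2 v.2).symm))

variable [FiniteDimensional ℝ E₁] [FiniteDimensional ℝ E₂]

theorem warpedForm_contMDiff (g₁ : RiemMetric I₁ M₁) (g₂ : RiemMetric I₂ M₂) (lam : M₁ → ℝ)
    (hlam : ContMDiff I₁ 𝓘(ℝ, ℝ) ∞ lam) :
    ContMDiff (I₁.prod I₂) ((I₁.prod I₂).prod 𝓘(ℝ, (E₁ × E₂) →L[ℝ] (E₁ × E₂) →L[ℝ] ℝ)) ∞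
      (fun p : M₁ × M₂ => Bundle.TotalSpace.mk' ((E₁ × E₂) →L[ℝ] (E₁ × E₂) →L[ℝ] ℝ)
        (E := fun p : M₁ × M₂ => TangentSpace (I₁.prod I₂) p →L[ℝ]
          TangentSpace (I₁.prod I₂) p →L[ℝ] ℝ) p (warpedForm g₁ g₂ lam p)) := by
  intro p₀
  have h₁ := g₁.contMDiff p₀.1
  have h₂ := g₂.contMDiff p₀.2
  rw [Bundle.contMDiffAt_section] at h₁ h₂ ⊢
  let A₁ : (E₁ →L[ℝ] E₁ →L[ℝ] ℝ) →L[ℝ] ((E₁ × E₂) →L[ℝ] (E₁ × E₂) →L[ℝ] ℝ) :=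
    LinearMap.toContinuousLinearMap
      { toFun := fun B => pullbackForm B (ContinuousLinearMap.fst ℝ E₁ E₂)
        map_add' := fun _ _ => rfl
        map_smul' := fun _ _ => rfl }
  let A₂ : (E₂ →L[ℝ] E₂ →L[ℝ] ℝ) →L[ℝ] ((E₁ × E₂) →L[ℝ] (E₁ × E₂) →L[ℝ] ℝ) :=
    LinearMap.toContinuousLinearMap
      { toFun := fun B => pullbackForm B (ContinuousLinearMap.snd ℝ E₁ E₂)
        map_add' := fun _ _ => rfl
        map_smul' := fun _ _ => rfl }
  have k₁ := (A₁.contMDiff (n := ∞)).contMDiffAt.comp p₀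
    (h₁.comp p₀ (contMDiffAt_fst (I := I₁) (J := I₂)))
  have k₂ := (A₂.contMDiff (n := ∞)).contMDiffAt.comp p₀
    (h₂.comp p₀ (contMDiffAt_snd (I := I₁) (J := I₂)))
  have kl : ContMDiffAt (I₁.prod I₂) 𝓘(ℝ, ℝ) ∞ (fun p : M₁ × M₂ => lam p.1 ^ 2) p₀ :=
    ((hlam p₀.1).comp p₀ (contMDiffAt_fst (I := I₁) (J := I₂))).pow 2
  refine (k₁.add (kl.smul k₂)).congr_of_eventuallyEq ?_
  have hs : (chartAt (ModelProd H₁ H₂) p₀).source ∈ 𝓝 p₀ := chart_source_mem_nhds _ _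
  filter_upwards [hs] with p hp
  refine ContinuousLinearMap.ext fun v => ContinuousLinearMap.ext fun w => ?_
  have e₀ := trivialization_form_apply p₀ p hp (warpedForm g₁ g₂ lam p) v w
  have e₁ := trivialization_form_apply p₀.1 p.1 hp.1 (g₁.inner p.1) v.1 w.1
  have e₂ := trivialization_form_apply p₀.2 p.2 hp.2 (g₂.inner p.2) v.2 w.2
  rw [warpedForm_apply, mfderiv_fst, mfderiv_snd] at e₀
  have ev := symmL_trivializationAt_prod (I₁ := I₁) (I₂ := I₂) p₀ p hp v
  have ew := symmL_trivializationAt_prod (I₁ := I₁) (I₂ := I₂) p₀ p hp w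
  refine e₀.trans (Eq.trans ?_ (congrArg₂ (fun a b : ℝ => a + lam p.1 ^ 2 * b) e₁ e₂).symm)
  have ev₁ := congrArg Prod.fst ev
  have ev₂ := congrArg Prod.snd ev
  have ew₁ := congrArg Prod.fst ew
  have ew₂ := congrArg Prod.snd ew
  exact congrArg₂ (fun a b : ℝ => a + lam p.1 ^ 2 * b)
    (congrArg₂ (fun a b => g₁.inner p.1 a b) ev₁ ew₁)
    (congrArg₂ (fun a b => g₂.inner p.2 a b) ev₂ ew₂)

/-- The warped product metric `g₁ ⊕ lam² g₂` on `M₁ × M₂`. -/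
def warpedMetric (g₁ : RiemMetric I₁ M₁) (g₂ : RiemMetric I₂ M₂) (lam : M₁ → ℝ)
    (hlam : ContMDiff I₁ 𝓘(ℝ, ℝ) ∞ lam) (hpos : ∀ x, 0 < lam x) :
    RiemMetric (I₁.prod I₂) (M₁ × M₂) where
  inner := warpedForm g₁ g₂ lam
  symm p X Y := by
    rw [warpedForm_apply, warpedForm_apply, g₁.symm, g₂.symm]
  pos p X hX := warpedForm_pos g₁ g₂ lam hpos p X hX
  isVonNBounded p := isVonNBounded_of_pos (E := E₁ × E₂) (warpedForm g₁ g₂ lam p)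
    (warpedForm_pos g₁ g₂ lam hpos p)
  contMDiff := warpedForm_contMDiff g₁ g₂ lam hlam

end Warped

end WarpedFlow

end

open WarpedFlow

/-!
The theorem is the Ricci flow equation of the warped product `g₁ ⊕ lam² g₂` read separately on
vectors tangent to the base and on vectors tangent to the fiber. On pairs `(v, 0)`, `(w, 0)` the
metric is `g₁(v, w)`, on pairs `(0, v)`, `(0, w)` it is `lam² g₂(v, w)`, so everything rests on the
two formulas (with `m₂` the dimension of the fiber)

* `Ric((v, 0), (w, 0)) = Ric₁(v, w) - (m₂ / lam) Hess lam (v, w)` (`ricci_warpedMetric_inl`),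
* `Ric((0, v), (0, w)) = Ric₂(v, w) - (lam Δ lam + (m₂ - 1) |grad lam|²) g₂(v, w)`
  (`ricci_warpedMetric_inr`),

together with `Δ lam² = 2 lam Δ lam + 2 |grad lam|²` (`laplacian_sq`). If `g₂` is a constant
Einstein metric, evaluating the second equation on a nonzero vector and dividing by its constant
squared length gives the equation for `lam²`.

The two formulas are proved in a product chart, where the metric is the warped product
`warpedChart` of the chart expressions of `g₁` and `g₂` (`chartMetric_warpedMetric`). Its
Christoffel symbols are guessed and verified against the equation that determines them
(`IsWarpedAt.chartChristoffel_warpedChart`); differentiating them gives the curvature, and the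
trace over the product is the sum of the traces of the two diagonal blocks (`trace_prod`). The
Hessian in the trace over the base enters through `∇_v grad f = Hess f (v, ·)` with an index
raised (`IsMetricAt.inverse_chartHessian`).
-/

noncomputable section

namespace WarpedFlow

/-! ### Metrics on open subsets of a vector space -/

section LocalMetric

variable {E : Type*} [NormedAddCommGroup E] [NormedSpace ℝ E]

/-- The germ of `G` at `u` is that of a Riemannian metric of class `C²`; this regularity is what
the curvature tensor needs. -/
structure IsMetricAt (G : E → E →L[ℝ] E →L[ℝ] ℝ) (u : E) : Prop where
  contDiffAt : ContDiffAt ℝ 2 G u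
  symm : ∀ᶠ a in 𝓝 u, ∀ v w, G a v w = G a w v
  pos : ∀ᶠ a in 𝓝 u, ∀ v, v ≠ 0 → 0 < G a v v

/-- The gradient of `f` with respect to the metric `G`, determined by `G(grad f, w) = df(w)`. -/
def chartGrad (G : E → E →L[ℝ] E →L[ℝ] ℝ) (f : E → ℝ) (u : E) : E :=
  (G u).inverse (fderiv ℝ f u)

theorem fderiv_apply_const {F F' : Type*} [NormedAddCommGroup F] [NormedSpace ℝ F]
    [NormedAddCommGroup F'] [NormedSpace ℝ F'] {A : E → F →L[ℝ] F'} {u : E}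
    (hA : DifferentiableAt ℝ A u) (v : E) (w : F) :
    fderiv ℝ (fun a => A a w) u v = fderiv ℝ A u v w := by
  have := (hA.hasFDerivAt.clm_apply (hasFDerivAt_const w u)).fderiv
  rw [this]
  simp

theorem fderiv_apply_const₂ {F F' F'' : Type*} [NormedAddCommGroup F] [NormedSpace ℝ F]
    [NormedAddCommGroup F'] [NormedSpace ℝ F'] [NormedAddCommGroup F''] [NormedSpace ℝ F'']
    {A : E → F →L[ℝ] F' →L[ℝ] F''} {u : E}
    (hA : DifferentiableAt ℝ A u) (v : E) (w : F) (z : F') :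
    fderiv ℝ (fun a => A a w z) u v = fderiv ℝ A u v w z := by
  rw [fderiv_apply_const (A := fun a => A a w) (hA.clm_apply (differentiableAt_const w)) v z,
    fderiv_apply_const hA]

namespace IsMetricAt

variable {G : E → E →L[ℝ] E →L[ℝ] ℝ} {u : E}

theorem eventually (h : IsMetricAt G u) : ∀ᶠ a in 𝓝 u, IsMetricAt G a := by
  filter_upwards [h.contDiffAt.eventually (by simp), h.symm.eventually_nhds,
    h.pos.eventually_nhds] with a h₁ h₂ h₃ using ⟨h₁, h₂, h₃⟩

theorem differentiableAt (h : IsMetricAt G u) : DifferentiableAt ℝ G u :=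
  h.contDiffAt.differentiableAt (by simp)

theorem apply_symm (h : IsMetricAt G u) (v w : E) : G u v w = G u w v :=
  h.symm.self_of_nhds v w

theorem fderiv_symm (h : IsMetricAt G u) (v w z : E) :
    fderiv ℝ G u v w z = fderiv ℝ G u v z w := by
  rw [← fderiv_apply_const₂ h.differentiableAt, ← fderiv_apply_const₂ h.differentiableAt]
  have : (fun a => G a w z) =ᶠ[𝓝 u] fun a => G a z w := by
    filter_upwards [h.symm] with a ha using ha w z
  rw [this.fderiv_eq]

theorem differentiableAt_chartKoszul (h : IsMetricAt G u) :
    DifferentiableAt ℝ (chartKoszul G) u := by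
  have h1 : DifferentiableAt ℝ (fderiv ℝ G) u :=
    (h.contDiffAt.fderiv_right (m := 1) (by norm_num)).differentiableAt (by simp)
  have h2 : DifferentiableAt ℝ (fun a => (fderiv ℝ G a).flip) u :=
    (ContinuousLinearMap.flipₗᵢ ℝ E E (E →L[ℝ] ℝ)).toContinuousLinearEquiv.differentiableAt.comp
      u h1
  unfold chartKoszul
  exact ((h1.add h2).sub ((differentiableAt_const _).clm_comp h2)).const_smul (1 / 2 : ℝ)

variable [FiniteDimensional ℝ E]

theorem isInvertible (h : IsMetricAt G u) : (G u).IsInvertible := by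
  have hinj : Function.Injective (G u : E →ₗ[ℝ] E →L[ℝ] ℝ) := by
    rw [← LinearMap.ker_eq_bot, LinearMap.ker_eq_bot']
    intro v hv
    by_contra hne
    have h1 := h.pos.self_of_nhds v hne
    have h2 : G u v = 0 := hv
    simp [h2] at h1
  have hdim : Module.finrank ℝ E = Module.finrank ℝ (E →L[ℝ] ℝ) := by
    rw [← LinearEquiv.finrank_eq (LinearMap.toContinuousLinearMap (𝕜 := ℝ) (E := E) (F' := ℝ))]
    exact (Subspace.dual_finrank_eq (K := ℝ) (V := E)).symm
  refine ⟨(LinearEquiv.ofInjectiveOfFinrankEq _ hinj hdim).toContinuousLinearEquiv, ?_⟩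
  ext v w
  rfl

theorem apply_inverse (h : IsMetricAt G u) (φ : E →L[ℝ] ℝ) (z : E) :
    G u ((G u).inverse φ) z = φ z := by
  rw [h.isInvertible.self_apply_inverse]

theorem ext (h : IsMetricAt G u) {a b : E} (hab : ∀ z, G u a z = G u b z) : a = b :=
  h.isInvertible.injective (ContinuousLinearMap.ext hab)

theorem differentiableAt_inverse (h : IsMetricAt G u) :
    DifferentiableAt ℝ (fun a => (G a).inverse) u := by
  have := FiniteDimensional.complete ℝ E
  obtain ⟨e, he⟩ := h.isInvertible
  have h1 : DifferentiableAt ℝ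
      (ContinuousLinearMap.inverse : (E →L[ℝ] E →L[ℝ] ℝ) → (E →L[ℝ] ℝ) →L[ℝ] E) (G u) := by
    rw [← he]
    exact (contDiffAt_map_inverse (n := 1) e).differentiableAt (by simp)
  exact h1.comp u h.differentiableAt

theorem differentiableAt_chartChristoffel (h : IsMetricAt G u) :
    DifferentiableAt ℝ (chartChristoffel G) u := by
  unfold chartChristoffel
  exact ((ContinuousLinearMap.compL ℝ E (E →L[ℝ] ℝ) E).differentiableAt.comp u
    h.differentiableAt_inverse).clm_comp h.differentiableAt_chartKoszul

theorem apply_chartChristoffel (h : IsMetricAt G u) (v w z : E) :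
    G u (chartChristoffel G u v w) z =
      (fderiv ℝ G u v w z + fderiv ℝ G u w v z - fderiv ℝ G u z v w) / 2 := by
  rw [chartChristoffel_apply, h.apply_inverse, chartKoszul_apply]

theorem apply_chartGrad (h : IsMetricAt G u) (f : E → ℝ) (z : E) :
    G u (chartGrad G f u) z = fderiv ℝ f u z :=
  h.apply_inverse _ z

theorem differentiableAt_chartGrad (h : IsMetricAt G u) {f : E → ℝ} (hf : ContDiffAt ℝ 2 f u) :
    DifferentiableAt ℝ (chartGrad G f) u :=
  h.differentiableAt_inverse.clm_apply
    ((hf.fderiv_right (m := 1) (by norm_num)).differentiableAt (by simp))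

/-- The Hessian is the covariant derivative of the gradient: `∇_v grad f` is obtained from
`Hess f (v, ·)` by raising an index. -/
theorem inverse_chartHessian (h : IsMetricAt G u) {f : E → ℝ} (hf : ContDiffAt ℝ 2 f u) (v : E) :
    (G u).inverse (chartHessian G f u v) =
      fderiv ℝ (chartGrad G f) u v + chartChristoffel G u v (chartGrad G f u) := by
  refine h.ext fun z => ?_
  have hf' : DifferentiableAt ℝ (fderiv ℝ f) u :=
    (hf.fderiv_right (m := 1) (by norm_num)).differentiableAt (by simp)
  have hg := h.differentiableAt_chartGrad hf
  -- differentiate `G(grad f, z) = df(z)`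
  have h1 : fderiv ℝ (fun a => G a (chartGrad G f a) z) u v = fderiv ℝ (fderiv ℝ f) u v z := by
    rw [← fderiv_apply_const hf']
    have : (fun a => G a (chartGrad G f a) z) =ᶠ[𝓝 u] fun a => fderiv ℝ f a z := by
      filter_upwards [h.eventually] with a ha using ha.apply_chartGrad f z
    rw [this.fderiv_eq]
  rw [fderiv_apply_const (A := fun a => G a (chartGrad G f a)) (h.differentiableAt.clm_apply hg),
    (h.differentiableAt.hasFDerivAt.clm_apply hg.hasFDerivAt).fderiv] at h1
  simp only [add_apply, ContinuousLinearMap.comp_apply,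
    ContinuousLinearMap.flip_apply] at h1
  rw [h.apply_inverse, chartHessian_apply, map_add, add_apply,
    h.apply_chartChristoffel, ← h.apply_chartGrad f (chartChristoffel G u v z), h.apply_symm,
    h.apply_chartChristoffel]
  have e1 := h.fderiv_symm v z (chartGrad G f u)
  have e2 := h.fderiv_symm z v (chartGrad G f u)
  linarith

end IsMetricAt

theorem chartHessian_sq {G : E → E →L[ℝ] E →L[ℝ] ℝ} {f : E → ℝ} {u : E}
    (hf : ContDiffAt ℝ 2 f u) (v w : E) :
    chartHessian G (fun a => f a ^ 2) u v w =
      2 * f u * chartHessian G f u v w + 2 * (fderiv ℝ f u v * fderiv ℝ f u w) := by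
  have hf' : DifferentiableAt ℝ (fderiv ℝ f) u :=
    (hf.fderiv_right (m := 1) (by norm_num)).differentiableAt (by simp)
  have h1 : fderiv ℝ (fun a => f a ^ 2) =ᶠ[𝓝 u] fun a => (2 * f a) • fderiv ℝ f a := by
    filter_upwards [hf.eventually (by simp)] with a ha
    have := (ha.differentiableAt (by simp)).hasFDerivAt.pow 2
    simpa using this.fderiv
  have h2 : fderiv ℝ (fun a => (2 * f a) • fderiv ℝ f a) u = _ :=
    (((hf.differentiableAt (by simp)).hasFDerivAt.const_mul 2).smul hf'.hasFDerivAt).fderiv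
  rw [chartHessian_apply, chartHessian_apply, h1.fderiv_eq, h1.self_of_nhds, h2]
  simp
  ring

theorem chartChristoffel_congr {G G' : E → E →L[ℝ] E →L[ℝ] ℝ} {u : E} (h : G =ᶠ[𝓝 u] G') :
    chartChristoffel G =ᶠ[𝓝 u] chartChristoffel G' := by
  filter_upwards [h, h.fderiv (𝕜 := ℝ)] with a h1 h2
  simp only [chartChristoffel, chartKoszul, h1, h2]

theorem chartRicci_congr {G G' : E → E →L[ℝ] E →L[ℝ] ℝ} {u : E} (h : G =ᶠ[𝓝 u] G') (w z : E) :
    chartRicci G u w z = chartRicci G' u w z := by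
  have h1 := chartChristoffel_congr h
  simp only [chartRicci, chartCurvature, h1.fderiv_eq, h1.self_of_nhds]

end LocalMetric

/-! ### Christoffel symbols of a warped product -/

section LocalWarped

variable {E₁ : Type*} [NormedAddCommGroup E₁] [NormedSpace ℝ E₁]
  {E₂ : Type*} [NormedAddCommGroup E₂] [NormedSpace ℝ E₂]

/-- The warped product metric `G₁ ⊕ L² G₂` on a product of vector spaces. -/
def warpedChart (G₁ : E₁ → E₁ →L[ℝ] E₁ →L[ℝ] ℝ) (G₂ : E₂ → E₂ →L[ℝ] E₂ →L[ℝ] ℝ) (L : E₁ → ℝ)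
    (u : E₁ × E₂) : (E₁ × E₂) →L[ℝ] (E₁ × E₂) →L[ℝ] ℝ :=
  pullbackForm (G₁ u.1) (ContinuousLinearMap.fst ℝ E₁ E₂)
    + (L u.1) ^ 2 • pullbackForm (G₂ u.2) (ContinuousLinearMap.snd ℝ E₁ E₂)

variable {G₁ : E₁ → E₁ →L[ℝ] E₁ →L[ℝ] ℝ} {G₂ : E₂ → E₂ →L[ℝ] E₂ →L[ℝ] ℝ} {L : E₁ → ℝ}
  {u : E₁ × E₂}

theorem warpedChart_apply (u v w : E₁ × E₂) :
    warpedChart G₁ G₂ L u v w = G₁ u.1 v.1 w.1 + L u.1 ^ 2 * G₂ u.2 v.2 w.2 := rfl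

theorem IsMetricAt.warpedChart (h₁ : IsMetricAt G₁ u.1) (h₂ : IsMetricAt G₂ u.2)
    (hL : ContDiffAt ℝ 2 L u.1) (hL0 : 0 < L u.1) : IsMetricAt (warpedChart G₁ G₂ L) u := by
  have c1 : ContinuousAt (Prod.fst : E₁ × E₂ → E₁) u := continuousAt_fst
  have c2 : ContinuousAt (Prod.snd : E₁ × E₂ → E₂) u := continuousAt_snd
  refine ⟨?_, ?_, ?_⟩
  · have k1 : ContDiffAt ℝ 2 (fun a : E₁ × E₂ => G₁ a.1) u := h₁.contDiffAt.comp u contDiffAt_fst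
    have k2 : ContDiffAt ℝ 2 (fun a : E₁ × E₂ => G₂ a.2) u := h₂.contDiffAt.comp u contDiffAt_snd
    have k3 : ContDiffAt ℝ 2 (fun a : E₁ × E₂ => L a.1) u := hL.comp u contDiffAt_fst
    unfold WarpedFlow.warpedChart pullbackForm
    exact (contDiffAt_const.clm_comp (k1.clm_comp contDiffAt_const)).add
      ((k3.pow 2).smul (contDiffAt_const.clm_comp (k2.clm_comp contDiffAt_const)))
  · filter_upwards [c1.eventually h₁.symm, c2.eventually h₂.symm] with a a1 a2 v w
    rw [warpedChart_apply, warpedChart_apply, a1, a2]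
  · have hL' : ∀ᶠ x in 𝓝 u.1, 0 < L x := hL.continuousAt.eventually_const_lt hL0
    filter_upwards [c1.eventually h₁.pos, c2.eventually h₂.pos, c1.eventually hL']
      with a a1 a2 a3 v hv
    have n1 : 0 ≤ G₁ a.1 v.1 v.1 := by
      rcases eq_or_ne v.1 0 with h | h
      · simp [h]
      · exact (a1 _ h).le
    have n2 : 0 ≤ G₂ a.2 v.2 v.2 := by
      rcases eq_or_ne v.2 0 with h | h
      · simp [h]
      · exact (a2 _ h).le
    rw [warpedChart_apply]
    by_cases hv1 : v.1 = 0
    · have hv2 : v.2 ≠ 0 := fun h => hv (Prod.ext hv1 h)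
      have := mul_pos (pow_pos a3 2) (a2 _ hv2)
      linarith
    · have := a1 _ hv1
      have := mul_nonneg (pow_pos a3 2).le n2
      linarith

theorem hasFDerivAt_comp_fst {F : Type*} [NormedAddCommGroup F] [NormedSpace ℝ F] {f : E₁ → F}
    (hf : DifferentiableAt ℝ f u.1) :
    HasFDerivAt (fun a : E₁ × E₂ => f a.1)
      ((fderiv ℝ f u.1).comp (ContinuousLinearMap.fst ℝ E₁ E₂)) u :=
  hf.hasFDerivAt.comp u hasFDerivAt_fst

theorem hasFDerivAt_comp_snd {F : Type*} [NormedAddCommGroup F] [NormedSpace ℝ F] {f : E₂ → F}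
    (hf : DifferentiableAt ℝ f u.2) :
    HasFDerivAt (fun a : E₁ × E₂ => f a.2)
      ((fderiv ℝ f u.2).comp (ContinuousLinearMap.snd ℝ E₁ E₂)) u :=
  hf.hasFDerivAt.comp u hasFDerivAt_snd

/-- The maps `G₁`, `G₂` and `L` are a base metric, a fiber metric and a positive warping function
of class `C²` near the components of the point `u`. -/
structure IsWarpedAt (G₁ : E₁ → E₁ →L[ℝ] E₁ →L[ℝ] ℝ) (G₂ : E₂ → E₂ →L[ℝ] E₂ →L[ℝ] ℝ)
    (L : E₁ → ℝ) (u : E₁ × E₂) : Prop where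
  base : IsMetricAt G₁ u.1
  fiber : IsMetricAt G₂ u.2
  contDiffAt : ContDiffAt ℝ 2 L u.1
  pos : 0 < L u.1

namespace IsWarpedAt

theorem isMetricAt (h : IsWarpedAt G₁ G₂ L u) : IsMetricAt (warpedChart G₁ G₂ L) u :=
  h.base.warpedChart h.fiber h.contDiffAt h.pos

theorem eventually (h : IsWarpedAt G₁ G₂ L u) : ∀ᶠ a in 𝓝 u, IsWarpedAt G₁ G₂ L a := by
  have c1 : ContinuousAt (Prod.fst : E₁ × E₂ → E₁) u := continuousAt_fst
  have c2 : ContinuousAt (Prod.snd : E₁ × E₂ → E₂) u := continuousAt_snd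
  filter_upwards [c1.eventually h.base.eventually, c2.eventually h.fiber.eventually,
    c1.eventually (h.contDiffAt.eventually (by simp)),
    c1.eventually (h.contDiffAt.continuousAt.eventually_const_lt h.pos)]
    with a h₁ h₂ h₃ h₄ using ⟨h₁, h₂, h₃, h₄⟩

theorem differentiableAt (h : IsWarpedAt G₁ G₂ L u) : DifferentiableAt ℝ L u.1 :=
  h.contDiffAt.differentiableAt (by simp)

theorem differentiableAt_fderiv (h : IsWarpedAt G₁ G₂ L u) :
    DifferentiableAt ℝ (fderiv ℝ L) u.1 :=
  (h.contDiffAt.fderiv_right (m := 1) (by norm_num)).differentiableAt (by simp)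

theorem fderiv_warpedChart (h : IsWarpedAt G₁ G₂ L u) (v w z : E₁ × E₂) :
    fderiv ℝ (warpedChart G₁ G₂ L) u v w z =
      fderiv ℝ G₁ u.1 v.1 w.1 z.1 + 2 * L u.1 * fderiv ℝ L u.1 v.1 * G₂ u.2 w.2 z.2
        + L u.1 ^ 2 * fderiv ℝ G₂ u.2 v.2 w.2 z.2 := by
  rw [← fderiv_apply_const₂ h.isMetricAt.differentiableAt]
  have d1 : DifferentiableAt ℝ (fun a => G₁ a w.1 z.1) u.1 :=
    (h.base.differentiableAt.clm_apply (differentiableAt_const _)).clm_apply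
      (differentiableAt_const _)
  have d2 : DifferentiableAt ℝ (fun a => G₂ a w.2 z.2) u.2 :=
    (h.fiber.differentiableAt.clm_apply (differentiableAt_const _)).clm_apply
      (differentiableAt_const _)
  have hd : fderiv ℝ (fun a => warpedChart G₁ G₂ L a w z) u = _ :=
    ((hasFDerivAt_comp_fst (E₂ := E₂) d1).add (((hasFDerivAt_comp_fst h.differentiableAt).pow 2).mul
      (hasFDerivAt_comp_snd d2))).fderiv
  rw [hd]
  simp [fderiv_apply_const₂ h.base.differentiableAt, fderiv_apply_const₂ h.fiber.differentiableAt]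
  ring

variable [FiniteDimensional ℝ E₁] [FiniteDimensional ℝ E₂]

theorem chartChristoffel_warpedChart (h : IsWarpedAt G₁ G₂ L u) (v w : E₁ × E₂) :
    chartChristoffel (warpedChart G₁ G₂ L) u v w =
      (chartChristoffel G₁ u.1 v.1 w.1 - (L u.1 * G₂ u.2 v.2 w.2) • chartGrad G₁ L u.1,
        chartChristoffel G₂ u.2 v.2 w.2 + (fderiv ℝ L u.1 v.1 * (L u.1)⁻¹) • w.2
          + (fderiv ℝ L u.1 w.1 * (L u.1)⁻¹) • v.2) := by
  refine h.isMetricAt.ext fun z => ?_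
  have hL := h.pos.ne'
  rw [h.isMetricAt.apply_chartChristoffel, h.fderiv_warpedChart, h.fderiv_warpedChart,
    h.fderiv_warpedChart, warpedChart_apply]
  simp only [map_add, map_sub, map_smul, add_apply, sub_apply, smul_apply, smul_eq_mul,
    h.base.apply_chartChristoffel, h.fiber.apply_chartChristoffel, h.base.apply_chartGrad]
  field_simp
  ring

theorem fderiv_chartChristoffel_fst (h : IsWarpedAt G₁ G₂ L u) (v w z : E₁ × E₂) :
    (fderiv ℝ (chartChristoffel (warpedChart G₁ G₂ L)) u v w z).1 =
      fderiv ℝ (chartChristoffel G₁) u.1 v.1 w.1 z.1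
        - (L u.1 * G₂ u.2 w.2 z.2) • fderiv ℝ (chartGrad G₁ L) u.1 v.1
        - (fderiv ℝ L u.1 v.1 * G₂ u.2 w.2 z.2 + L u.1 * fderiv ℝ G₂ u.2 v.2 w.2 z.2)
          • chartGrad G₁ L u.1 := by
  have hΓ := h.isMetricAt.differentiableAt_chartChristoffel
  have d1 : DifferentiableAt ℝ (fun a => chartChristoffel G₁ a w.1 z.1) u.1 :=
    (h.base.differentiableAt_chartChristoffel.clm_apply (differentiableAt_const _)).clm_apply
      (differentiableAt_const _)
  have d2 : DifferentiableAt ℝ (fun a => G₂ a w.2 z.2) u.2 :=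
    (h.fiber.differentiableAt.clm_apply (differentiableAt_const _)).clm_apply
      (differentiableAt_const _)
  have d0 : DifferentiableAt ℝ (fun a => chartChristoffel (warpedChart G₁ G₂ L) a w z) u :=
    (hΓ.clm_apply (differentiableAt_const _)).clm_apply (differentiableAt_const _)
  have e0 : fderiv ℝ (fun a => (chartChristoffel (warpedChart G₁ G₂ L) a w z).1) u = _ :=
    d0.hasFDerivAt.fst.fderiv
  have e1 : (fun a => (chartChristoffel (warpedChart G₁ G₂ L) a w z).1) =ᶠ[𝓝 u]
      fun a => chartChristoffel G₁ a.1 w.1 z.1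
        - (L a.1 * G₂ a.2 w.2 z.2) • chartGrad G₁ L a.1 := by
    filter_upwards [h.eventually] with a ha
    rw [ha.chartChristoffel_warpedChart]
  have e2 : fderiv ℝ (fun a : E₁ × E₂ => chartChristoffel G₁ a.1 w.1 z.1
        - (L a.1 * G₂ a.2 w.2 z.2) • chartGrad G₁ L a.1) u = _ :=
    ((hasFDerivAt_comp_fst d1).sub (((hasFDerivAt_comp_fst h.differentiableAt).mul
      (hasFDerivAt_comp_snd d2)).smul
      (hasFDerivAt_comp_fst (h.base.differentiableAt_chartGrad h.contDiffAt)))).fderiv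
  rw [e1.fderiv_eq, e2] at e0
  have e3 := DFunLike.congr_fun e0 v
  rw [ContinuousLinearMap.comp_apply, fderiv_apply_const₂ hΓ] at e3
  refine e3.symm.trans ?_
  simp [fderiv_apply_const₂ h.base.differentiableAt_chartChristoffel,
    fderiv_apply_const₂ h.fiber.differentiableAt]
  module

theorem fderiv_chartChristoffel_snd (h : IsWarpedAt G₁ G₂ L u) (v w z : E₁ × E₂) :
    (fderiv ℝ (chartChristoffel (warpedChart G₁ G₂ L)) u v w z).2 =
      fderiv ℝ (chartChristoffel G₂) u.2 v.2 w.2 z.2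
        + ((fderiv ℝ (fderiv ℝ L) u.1 v.1 w.1
            - fderiv ℝ L u.1 v.1 * fderiv ℝ L u.1 w.1 * (L u.1)⁻¹) * (L u.1)⁻¹) • z.2
        + ((fderiv ℝ (fderiv ℝ L) u.1 v.1 z.1
            - fderiv ℝ L u.1 v.1 * fderiv ℝ L u.1 z.1 * (L u.1)⁻¹) * (L u.1)⁻¹) • w.2 := by
  have hΓ := h.isMetricAt.differentiableAt_chartChristoffel
  have d1 : DifferentiableAt ℝ (fun a => chartChristoffel G₂ a w.2 z.2) u.2 :=
    (h.fiber.differentiableAt_chartChristoffel.clm_apply (differentiableAt_const _)).clm_apply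
      (differentiableAt_const _)
  have d2 : ∀ x : E₁, DifferentiableAt ℝ (fun a => fderiv ℝ L a x) u.1 := fun x =>
    h.differentiableAt_fderiv.clm_apply (differentiableAt_const _)
  have d0 : DifferentiableAt ℝ (fun a => chartChristoffel (warpedChart G₁ G₂ L) a w z) u :=
    (hΓ.clm_apply (differentiableAt_const _)).clm_apply (differentiableAt_const _)
  have e0 : fderiv ℝ (fun a => (chartChristoffel (warpedChart G₁ G₂ L) a w z).2) u = _ :=
    d0.hasFDerivAt.snd.fderiv
  have e1 : (fun a => (chartChristoffel (warpedChart G₁ G₂ L) a w z).2) =ᶠ[𝓝 u]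
      fun a => chartChristoffel G₂ a.2 w.2 z.2 + (fderiv ℝ L a.1 w.1 * (L a.1)⁻¹) • z.2
          + (fderiv ℝ L a.1 z.1 * (L a.1)⁻¹) • w.2 := by
    filter_upwards [h.eventually] with a ha
    rw [ha.chartChristoffel_warpedChart]
  have hinv : HasFDerivAt (fun a : E₁ × E₂ => (L a.1)⁻¹) _ u :=
    (hasDerivAt_inv h.pos.ne').comp_hasFDerivAt u (hasFDerivAt_comp_fst h.differentiableAt)
  have e2 : fderiv ℝ (fun a : E₁ × E₂ => chartChristoffel G₂ a.2 w.2 z.2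
        + (fderiv ℝ L a.1 w.1 * (L a.1)⁻¹) • z.2
          + (fderiv ℝ L a.1 z.1 * (L a.1)⁻¹) • w.2) u = _ :=
    (((hasFDerivAt_comp_snd d1).add (((hasFDerivAt_comp_fst (d2 w.1)).mul hinv).smul_const z.2)).add
      (((hasFDerivAt_comp_fst (d2 z.1)).mul hinv).smul_const w.2)).fderiv
  rw [e1.fderiv_eq, e2] at e0
  have e3 := DFunLike.congr_fun e0 v
  rw [ContinuousLinearMap.comp_apply, fderiv_apply_const₂ hΓ] at e3
  refine e3.symm.trans ?_
  simp [fderiv_apply_const₂ h.fiber.differentiableAt_chartChristoffel,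
    fderiv_apply_const h.differentiableAt_fderiv]
  have hL := h.pos.ne'
  congr 1
  · congr 2
    field_simp
    ring
  · congr 1
    field_simp
    ring

end IsWarpedAt

end LocalWarped

/-! ### Traces and the Ricci tensor of a warped product -/

section LocalRicci

variable {E₁ : Type*} [NormedAddCommGroup E₁] [NormedSpace ℝ E₁] [FiniteDimensional ℝ E₁]
  {E₂ : Type*} [NormedAddCommGroup E₂] [NormedSpace ℝ E₂] [FiniteDimensional ℝ E₂]

theorem trace_prod (A : (E₁ × E₂) →ₗ[ℝ] (E₁ × E₂)) :
    LinearMap.trace ℝ (E₁ × E₂) A =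
      LinearMap.trace ℝ E₁ (LinearMap.fst ℝ E₁ E₂ ∘ₗ A ∘ₗ LinearMap.inl ℝ E₁ E₂)
        + LinearMap.trace ℝ E₂ (LinearMap.snd ℝ E₁ E₂ ∘ₗ A ∘ₗ LinearMap.inr ℝ E₁ E₂) := by
  have hA : A = (A ∘ₗ LinearMap.inl ℝ E₁ E₂) ∘ₗ LinearMap.fst ℝ E₁ E₂
      + (A ∘ₗ LinearMap.inr ℝ E₁ E₂) ∘ₗ LinearMap.snd ℝ E₁ E₂ := by
    refine LinearMap.ext fun v => ?_
    simp [← map_add]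
  conv_lhs => rw [hA]
  rw [map_add, LinearMap.trace_comp_comm', LinearMap.trace_comp_comm' (LinearMap.snd ℝ E₁ E₂)]

/-- The Laplacian of `f` with respect to the metric `G`. -/
def chartLaplacian {E : Type*} [NormedAddCommGroup E] [NormedSpace ℝ E]
    (G : E → E →L[ℝ] E →L[ℝ] ℝ) (f : E → ℝ) (u : E) : ℝ :=
  LinearMap.trace ℝ E ((G u).inverse ∘L chartHessian G f u : E →L[ℝ] E).toLinearMap

/-- `Δ f² = 2 f Δ f + 2 |grad f|²`. -/
theorem chartLaplacian_sq {G : E₁ → E₁ →L[ℝ] E₁ →L[ℝ] ℝ} {f : E₁ → ℝ} {u : E₁}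
    (hf : ContDiffAt ℝ 2 f u) :
    chartLaplacian G (fun a => f a ^ 2) u =
      2 * f u * chartLaplacian G f u + 2 * fderiv ℝ f u (chartGrad G f u) := by
  have h : ((G u).inverse ∘L chartHessian G (fun a => f a ^ 2) u : E₁ →L[ℝ] E₁).toLinearMap =
      (2 * f u) • ((G u).inverse ∘L chartHessian G f u : E₁ →L[ℝ] E₁).toLinearMap
        + (2 : ℝ) • (fderiv ℝ f u).toLinearMap.smulRight (chartGrad G f u) := by
    ext v
    have : chartHessian G (fun a => f a ^ 2) u v =
        (2 * f u) • chartHessian G f u v + (2 * fderiv ℝ f u v) • fderiv ℝ f u := by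
      ext w
      rw [chartHessian_sq hf]
      simp
      ring
    simp [this, chartGrad, mul_smul]
  rw [chartLaplacian, h, map_add, map_smul, map_smul, LinearMap.trace_smulRight]
  rfl

namespace IsWarpedAt

variable {G₁ : E₁ → E₁ →L[ℝ] E₁ →L[ℝ] ℝ} {G₂ : E₂ → E₂ →L[ℝ] E₂ →L[ℝ] ℝ} {L : E₁ → ℝ}
  {u : E₁ × E₂}

/-- The Ricci tensor of a warped product in base directions. Only the trace over the fiber
differs from the Ricci tensor of the base: there the curvature operator is the multiple
`-Hess L (w, z) / L` of the identity. -/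
theorem chartRicci_base (h : IsWarpedAt G₁ G₂ L u) (w z : E₁) :
    chartRicci (warpedChart G₁ G₂ L) u (w, 0) (z, 0) =
      chartRicci G₁ u.1 w z
        - Module.finrank ℝ E₂ / L u.1 * chartHessian G₁ L u.1 w z := by
  have hL := h.pos.ne'
  rw [chartRicci, trace_prod]
  have e1 : LinearMap.fst ℝ E₁ E₂ ∘ₗ (chartCurvature (warpedChart G₁ G₂ L) u (w, 0) (z, 0) :
      (E₁ × E₂) →ₗ[ℝ] (E₁ × E₂)) ∘ₗ LinearMap.inl ℝ E₁ E₂ = chartCurvature G₁ u.1 w z := by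
    ext v
    simp [chartCurvature_apply, h.fderiv_chartChristoffel_fst, h.chartChristoffel_warpedChart]
  have e2 : LinearMap.snd ℝ E₁ E₂ ∘ₗ (chartCurvature (warpedChart G₁ G₂ L) u (w, 0) (z, 0) :
      (E₁ × E₂) →ₗ[ℝ] (E₁ × E₂)) ∘ₗ LinearMap.inr ℝ E₁ E₂ =
      (-(chartHessian G₁ L u.1 w z / L u.1)) • LinearMap.id := by
    ext v
    simp [chartCurvature_apply, h.fderiv_chartChristoffel_snd, h.chartChristoffel_warpedChart,
      chartHessian_apply]
    match_scalars
    field_simp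
    ring
  rw [e1, e2, map_smul, LinearMap.trace_id, chartRicci]
  simp
  ring

/-- The Ricci tensor of a warped product in fiber directions. The trace over the base of the
curvature operator is that of `-L G₂(w, z) ∇ grad L`; the trace over the fiber is that of the
curvature operator of the fiber minus `|grad L|² (G₂(w, z) v - G₂(v, z) w)`. -/
theorem chartRicci_fiber (h : IsWarpedAt G₁ G₂ L u) (w z : E₂) :
    chartRicci (warpedChart G₁ G₂ L) u (0, w) (0, z) =
      chartRicci G₂ u.2 w z
        - (L u.1 * chartLaplacian G₁ L u.1
          + (Module.finrank ℝ E₂ - 1) * fderiv ℝ L u.1 (chartGrad G₁ L u.1)) * G₂ u.2 w z := by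
  have hL := h.pos.ne'
  rw [chartRicci, trace_prod]
  have e1 : LinearMap.fst ℝ E₁ E₂ ∘ₗ (chartCurvature (warpedChart G₁ G₂ L) u (0, w) (0, z) :
      (E₁ × E₂) →ₗ[ℝ] (E₁ × E₂)) ∘ₗ LinearMap.inl ℝ E₁ E₂ =
      (-(L u.1 * G₂ u.2 w z)) •
        ((G₁ u.1).inverse ∘L chartHessian G₁ L u.1 : E₁ →L[ℝ] E₁).toLinearMap := by
    ext v
    simp [chartCurvature_apply, h.fderiv_chartChristoffel_fst, h.chartChristoffel_warpedChart,
      h.base.inverse_chartHessian h.contDiffAt]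
    match_scalars
    · ring
    · field_simp
      ring
    · ring
  have e2 : LinearMap.snd ℝ E₁ E₂ ∘ₗ (chartCurvature (warpedChart G₁ G₂ L) u (0, w) (0, z) :
      (E₁ × E₂) →ₗ[ℝ] (E₁ × E₂)) ∘ₗ LinearMap.inr ℝ E₁ E₂ =
      (chartCurvature G₂ u.2 w z).toLinearMap
        - (fderiv ℝ L u.1 (chartGrad G₁ L u.1)) •
          (G₂ u.2 w z • LinearMap.id - ((G₂ u.2).flip z).toLinearMap.smulRight w) := by
    ext v
    simp [chartCurvature_apply, h.fderiv_chartChristoffel_snd, h.chartChristoffel_warpedChart]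
    match_scalars <;> field_simp
  rw [e1, e2, map_smul, map_sub, map_smul, map_sub, map_smul, LinearMap.trace_id,
    LinearMap.trace_smulRight, chartRicci, chartLaplacian]
  simp
  ring

end IsWarpedAt

end LocalRicci

/-! ### Passage between a manifold and its charts -/

section Charts

variable {E : Type*} [NormedAddCommGroup E] [NormedSpace ℝ E]
  {H : Type*} [TopologicalSpace H] {I : ModelWithCorners ℝ E H}
  {M : Type*} [TopologicalSpace M] [ChartedSpace H M] [IsManifold I ∞ M]

/-- `T_x M` is identified with the model space by means of the preferred chart at `x`, so that
the differential of this chart at `x` is the identity. -/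
theorem mfderiv_extChartAt_self (x : M) (v : TangentSpace I x) :
    (mfderiv I 𝓘(ℝ, E) (extChartAt I x) x v : E) = v := by
  rw [← TangentBundle.continuousLinearMapAt_trivializationAt (mem_chart_source H x),
    TangentBundle.continuousLinearMapAt_trivializationAt_eq_core (mem_chart_source H x)]
  exact tangentCoordChange_self (I := I) (x := x) (z := x) (v := (v : E)) (mem_extChartAt_source x)

theorem symmL_trivializationAt_self (x : M) (v : E) :
    ((trivializationAt E (TangentSpace I) x).symmL ℝ x v : E) = v :=
  (symmL_trivializationAt_apply x x (mem_chart_source H x) v).trans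
    (tangentCoordChange_self (I := I) (x := x) (z := x) (v := (v : E))
      (mem_extChartAt_source x))

theorem chartMetric_apply (g : RiemMetric I M) (x₀ : M) {u : E}
    (hu : u ∈ (extChartAt I x₀).target) (v w : E) :
    chartMetric g x₀ u v w =
      g.inner ((extChartAt I x₀).symm u)
        ((trivializationAt E (TangentSpace I) x₀).symmL ℝ ((extChartAt I x₀).symm u) v)
        ((trivializationAt E (TangentSpace I) x₀).symmL ℝ ((extChartAt I x₀).symm u) w) := by
  have hs : (extChartAt I x₀).symm u ∈ (chartAt H x₀).source := by
    rw [← extChartAt_source I]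
    exact (extChartAt I x₀).map_target hu
  rw [TangentBundle.symmL_trivializationAt hs, (extChartAt I x₀).right_inv hu]
  rfl

theorem chartMetric_self (g : RiemMetric I M) (x : M) :
    chartMetric g x (extChartAt I x x) = g.inner x := by
  have h0 : (extChartAt I x).symm (extChartAt I x x) = x := extChartAt_to_inv x
  refine ContinuousLinearMap.ext fun v => ContinuousLinearMap.ext fun w => ?_
  refine (chartMetric_apply g x (mem_extChartAt_target x) v w).trans ?_
  rw [h0]
  exact congrArg₂ (fun a b => g.inner x a b) (symmL_trivializationAt_self (I := I) x v)
    (symmL_trivializationAt_self (I := I) x w)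

variable [I.Boundaryless]

theorem contDiffAt_comp_extChartAt_symm {F : Type*} [NormedAddCommGroup F] [NormedSpace ℝ F]
    {f : M → F} {x : M} (hf : ContMDiffAt I 𝓘(ℝ, F) ∞ f x) :
    ContDiffAt ℝ 2 (f ∘ (extChartAt I x).symm) (extChartAt I x x) := by
  have h := (contMDiffAt_iff.1 hf).2
  rw [I.range_eq_univ, contDiffWithinAt_univ] at h
  exact h.of_le (WithTop.coe_le_coe.2 (le_top : (2 : ℕ∞) ≤ ⊤))

theorem chartMetric_isMetricAt (g : RiemMetric I M) (x : M) :
    IsMetricAt (chartMetric g x) (extChartAt I x x) := by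
  have ht : (extChartAt I x).target ∈ 𝓝 (extChartAt I x x) := extChartAt_target_mem_nhds x
  refine ⟨?_, ?_, ?_⟩
  · have h := g.contMDiff x
    rw [Bundle.contMDiffAt_section] at h
    refine (contDiffAt_comp_extChartAt_symm h).congr_of_eventuallyEq ?_
    filter_upwards [ht] with u hu
    have hs : (extChartAt I x).symm u ∈ (chartAt H x).source := by
      rw [← extChartAt_source I]
      exact (extChartAt I x).map_target hu
    refine ContinuousLinearMap.ext fun v => ContinuousLinearMap.ext fun w => ?_
    exact (chartMetric_apply g x hu v w).trans (trivialization_form_apply x _ hs _ v w).symm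
  · filter_upwards [ht] with u hu v w
    rw [chartMetric_apply g x hu, chartMetric_apply g x hu, g.symm]
  · filter_upwards [ht] with u hu v hv
    have hs : (extChartAt I x).symm u ∈ (trivializationAt E (TangentSpace I) x).baseSet := by
      rw [TangentBundle.trivializationAt_baseSet, ← extChartAt_source I]
      exact (extChartAt I x).map_target hu
    rw [chartMetric_apply g x hu]
    refine g.pos _ _ fun h0 => hv ?_
    rw [← (trivializationAt E (TangentSpace I) x).continuousLinearMapAt_symmL (R := ℝ) hs v, h0,
      map_zero]

theorem ricci_eq_chartRicci (g : RiemMetric I M) (x : M) (v w : TangentSpace I x) :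
    ricci g x v w = chartRicci (chartMetric g x) (extChartAt I x x) v w :=
  congrArg₂ (chartRicci (chartMetric g x) (extChartAt I x x))
    (mfderiv_extChartAt_self x v) (mfderiv_extChartAt_self x w)

theorem hessian_apply (g : RiemMetric I M) (f : M → ℝ) (x : M) (v w : TangentSpace I x) :
    hessian g f x v w =
      chartHessian (chartMetric g x) (f ∘ (extChartAt I x).symm) (extChartAt I x x) v w :=
  congrArg₂ (fun a b : E => chartHessian (chartMetric g x) (f ∘ (extChartAt I x).symm)
    (extChartAt I x x) a b) (mfderiv_extChartAt_self x v) (mfderiv_extChartAt_self x w)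

theorem laplacian_eq_chartLaplacian (g : RiemMetric I M) (f : M → ℝ) (x : M) :
    laplacian g f x =
      chartLaplacian (chartMetric g x) (f ∘ (extChartAt I x).symm) (extChartAt I x x) := by
  have h : hessian g f x = chartHessian (chartMetric g x) (f ∘ (extChartAt I x).symm)
      (extChartAt I x x) :=
    ContinuousLinearMap.ext fun v => ContinuousLinearMap.ext fun w => hessian_apply g f x v w
  rw [laplacian, h, chartLaplacian, chartMetric_self]
  rfl

theorem grad_eq_chartGrad (g : RiemMetric I M) {f : M → ℝ} {x : M}
    (hf : MDifferentiableAt I 𝓘(ℝ, ℝ) f x) :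
    grad g f x =
      chartGrad (chartMetric g x) (f ∘ (extChartAt I x).symm) (extChartAt I x x) := by
  rw [grad, chartGrad, chartMetric_self, hf.mfderiv, I.range_eq_univ, fderivWithin_univ]
  rfl

theorem gradNormSq_eq [FiniteDimensional ℝ E] (g : RiemMetric I M) {f : M → ℝ} {x : M}
    (hf : MDifferentiableAt I 𝓘(ℝ, ℝ) f x) :
    gradNormSq g f x =
      fderiv ℝ (f ∘ (extChartAt I x).symm) (extChartAt I x x)
        (chartGrad (chartMetric g x) (f ∘ (extChartAt I x).symm) (extChartAt I x x)) := by
  rw [gradNormSq, grad_eq_chartGrad g hf, ← (chartMetric_isMetricAt g x).apply_chartGrad,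
    chartMetric_self]
  rfl

theorem laplacian_sq [FiniteDimensional ℝ E] (g : RiemMetric I M) {f : M → ℝ}
    (hf : ContMDiff I 𝓘(ℝ, ℝ) ∞ f) (x : M) :
    laplacian g (fun y => f y ^ 2) x = 2 * f x * laplacian g f x + 2 * gradNormSq g f x := by
  have h0 : (f ∘ (extChartAt I x).symm) (extChartAt I x x) = f x :=
    congrArg f (extChartAt_to_inv x)
  have h := chartLaplacian_sq (G := chartMetric g x) (contDiffAt_comp_extChartAt_symm (hf x))
  rw [h0] at h
  rw [laplacian_eq_chartLaplacian, laplacian_eq_chartLaplacian,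
    gradNormSq_eq g ((hf x).mdifferentiableAt (by simp))]
  exact h

end Charts

/-! ### Ricci curvature of a warped product manifold -/

section WarpedManifold

variable {E₁ : Type*} [NormedAddCommGroup E₁] [NormedSpace ℝ E₁] [FiniteDimensional ℝ E₁]
  {H₁ : Type*} [TopologicalSpace H₁] {I₁ : ModelWithCorners ℝ E₁ H₁} [I₁.Boundaryless]
  {M₁ : Type*} [TopologicalSpace M₁] [ChartedSpace H₁ M₁] [IsManifold I₁ ∞ M₁]
  {E₂ : Type*} [NormedAddCommGroup E₂] [NormedSpace ℝ E₂] [FiniteDimensional ℝ E₂]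
  {H₂ : Type*} [TopologicalSpace H₂] {I₂ : ModelWithCorners ℝ E₂ H₂} [I₂.Boundaryless]
  {M₂ : Type*} [TopologicalSpace M₂] [ChartedSpace H₂ M₂] [IsManifold I₂ ∞ M₂]

theorem warpedMetric_inner_apply (g₁ : RiemMetric I₁ M₁) (g₂ : RiemMetric I₂ M₂)
    {lam : M₁ → ℝ} (hlam : ContMDiff I₁ 𝓘(ℝ, ℝ) ∞ lam) (hpos : ∀ x, 0 < lam x)
    (x : M₁) (y : M₂)
    (X Y : TangentSpace (I₁.prod I₂) (x, y)) :
    (warpedMetric g₁ g₂ lam hlam hpos).inner (x, y) X Y =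
      g₁.inner x (X : E₁ × E₂).1 (Y : E₁ × E₂).1
        + lam x ^ 2 * g₂.inner y (X : E₁ × E₂).2 (Y : E₁ × E₂).2 := by
  refine (warpedForm_apply g₁ g₂ lam (x, y) X Y).trans ?_
  rw [mfderiv_fst, mfderiv_snd]
  rfl

theorem warpedMetric_inner_inl (g₁ : RiemMetric I₁ M₁) (g₂ : RiemMetric I₂ M₂)
    {lam : M₁ → ℝ} (hlam : ContMDiff I₁ 𝓘(ℝ, ℝ) ∞ lam) (hpos : ∀ x, 0 < lam x)
    (x : M₁) (y : M₂)
    (v w : TangentSpace I₁ x) :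
    (warpedMetric g₁ g₂ lam hlam hpos).inner (x, y) ((v, 0) : E₁ × E₂) ((w, 0) : E₁ × E₂) =
      g₁.inner x v w := by
  refine (warpedMetric_inner_apply g₁ g₂ hlam hpos x y _ _).trans ?_
  have : g₂.inner y (0 : TangentSpace I₂ y) (0 : TangentSpace I₂ y) = 0 := by simp
  exact (congrArg (fun r : ℝ => g₁.inner x v w + lam x ^ 2 * r) this).trans (by simp)

theorem warpedMetric_inner_inr (g₁ : RiemMetric I₁ M₁) (g₂ : RiemMetric I₂ M₂)
    {lam : M₁ → ℝ} (hlam : ContMDiff I₁ 𝓘(ℝ, ℝ) ∞ lam) (hpos : ∀ x, 0 < lam x)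
    (x : M₁) (y : M₂)
    (v w : TangentSpace I₂ y) :
    (warpedMetric g₁ g₂ lam hlam hpos).inner (x, y) ((0, v) : E₁ × E₂) ((0, w) : E₁ × E₂) =
      lam x ^ 2 * g₂.inner y v w := by
  refine (warpedMetric_inner_apply g₁ g₂ hlam hpos x y _ _).trans ?_
  have : g₁.inner x (0 : TangentSpace I₁ x) (0 : TangentSpace I₁ x) = 0 := by simp
  exact (congrArg (fun r : ℝ => r + lam x ^ 2 * g₂.inner y v w) this).trans (by simp)

theorem isWarpedAt_chartMetric (g₁ : RiemMetric I₁ M₁) (g₂ : RiemMetric I₂ M₂)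
    {lam : M₁ → ℝ} (hlam : ContMDiff I₁ 𝓘(ℝ, ℝ) ∞ lam) (hpos : ∀ x, 0 < lam x)
    (x : M₁) (y : M₂) :
    IsWarpedAt (chartMetric g₁ x) (chartMetric g₂ y) (lam ∘ (extChartAt I₁ x).symm)
      (extChartAt I₁ x x, extChartAt I₂ y y) where
  base := chartMetric_isMetricAt g₁ x
  fiber := chartMetric_isMetricAt g₂ y
  contDiffAt := contDiffAt_comp_extChartAt_symm (hlam x)
  pos := hpos _

/-- In a product chart a warped product metric is the warped product of the chart expressions. -/
theorem chartMetric_warpedMetric (g₁ : RiemMetric I₁ M₁) (g₂ : RiemMetric I₂ M₂)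
    {lam : M₁ → ℝ} (hlam : ContMDiff I₁ 𝓘(ℝ, ℝ) ∞ lam) (hpos : ∀ x, 0 < lam x)
    (x : M₁) (y : M₂) :
    chartMetric (warpedMetric g₁ g₂ lam hlam hpos) (x, y)
      =ᶠ[𝓝 (extChartAt I₁ x x, extChartAt I₂ y y)]
        warpedChart (chartMetric g₁ x) (chartMetric g₂ y) (lam ∘ (extChartAt I₁ x).symm) := by
  have ht : (extChartAt (I₁.prod I₂) (x, y)).target ∈
      𝓝 (extChartAt (I₁.prod I₂) (x, y) (x, y)) := extChartAt_target_mem_nhds (x, y)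
  have he : extChartAt (I₁.prod I₂) (x, y) =
      (extChartAt I₁ x).prod (extChartAt I₂ y) := extChartAt_prod (x, y)
  filter_upwards [show (extChartAt (I₁.prod I₂) (x, y)).target ∈
    𝓝 (extChartAt I₁ x x, extChartAt I₂ y y) by rw [he] at ht ⊢; exact ht] with u hu
  have hu' : u.1 ∈ (extChartAt I₁ x).target ∧ u.2 ∈ (extChartAt I₂ y).target := by
    rw [he] at hu; exact hu
  have hs : (extChartAt (I₁.prod I₂) (x, y)).symm u ∈
      (chartAt (ModelProd H₁ H₂) (x, y)).source := by
    rw [← extChartAt_source (I₁.prod I₂)]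
    exact (extChartAt (I₁.prod I₂) (x, y)).map_target hu
  have hp : (extChartAt (I₁.prod I₂) (x, y)).symm u =
      ((extChartAt I₁ x).symm u.1, (extChartAt I₂ y).symm u.2) := by
    rw [he]; rfl
  refine ContinuousLinearMap.ext fun v => ContinuousLinearMap.ext fun w => ?_
  refine (chartMetric_apply _ (x, y) hu v w).trans ?_
  rw [hp] at hs ⊢
  refine (warpedMetric_inner_apply g₁ g₂ hlam hpos _ _ _ _).trans ?_
  have ev := symmL_trivializationAt_prod (I₁ := I₁) (I₂ := I₂) (x, y) _ hs v
  have ew := symmL_trivializationAt_prod (I₁ := I₁) (I₂ := I₂) (x, y) _ hs w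
  rw [warpedChart_apply, chartMetric_apply g₁ x hu'.1, chartMetric_apply g₂ y hu'.2]
  exact congrArg₂ (fun a b : ℝ => a + lam ((extChartAt I₁ x).symm u.1) ^ 2 * b)
    (congrArg₂ (fun a b => g₁.inner ((extChartAt I₁ x).symm u.1) a b)
      (congrArg Prod.fst ev) (congrArg Prod.fst ew))
    (congrArg₂ (fun a b => g₂.inner ((extChartAt I₂ y).symm u.2) a b)
      (congrArg Prod.snd ev) (congrArg Prod.snd ew))

theorem ricci_warpedMetric (g₁ : RiemMetric I₁ M₁) (g₂ : RiemMetric I₂ M₂)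
    {lam : M₁ → ℝ} (hlam : ContMDiff I₁ 𝓘(ℝ, ℝ) ∞ lam) (hpos : ∀ x, 0 < lam x)
    (x : M₁) (y : M₂)
    (X Y : TangentSpace (I₁.prod I₂) (x, y)) :
    ricci (warpedMetric g₁ g₂ lam hlam hpos) (x, y) X Y =
      chartRicci (warpedChart (chartMetric g₁ x) (chartMetric g₂ y)
        (lam ∘ (extChartAt I₁ x).symm)) (extChartAt I₁ x x, extChartAt I₂ y y) X Y := by
  have he : extChartAt (I₁.prod I₂) (x, y) (x, y) = (extChartAt I₁ x x, extChartAt I₂ y y) := by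
    rw [extChartAt_prod]; rfl
  rw [ricci_eq_chartRicci, he]
  exact chartRicci_congr (chartMetric_warpedMetric g₁ g₂ hlam hpos x y) _ _

/-- `Ric((v, 0), (w, 0)) = Ric₁(v, w) - (m₂ / lam) Hess lam (v, w)` for a warped product. -/
theorem ricci_warpedMetric_inl (g₁ : RiemMetric I₁ M₁) (g₂ : RiemMetric I₂ M₂)
    {lam : M₁ → ℝ} (hlam : ContMDiff I₁ 𝓘(ℝ, ℝ) ∞ lam) (hpos : ∀ x, 0 < lam x)
    (x : M₁) (y : M₂)
    (v w : TangentSpace I₁ x) :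
    ricci (warpedMetric g₁ g₂ lam hlam hpos) (x, y) ((v, 0) : E₁ × E₂) ((w, 0) : E₁ × E₂) =
      ricci g₁ x v w - Module.finrank ℝ E₂ / lam x * hessian g₁ lam x v w := by
  have h0 : (lam ∘ (extChartAt I₁ x).symm) (extChartAt I₁ x x) = lam x :=
    congrArg lam (extChartAt_to_inv x)
  have h := (isWarpedAt_chartMetric g₁ g₂ hlam hpos x y).chartRicci_base v w
  rw [h0] at h
  rw [hessian_apply, ricci_eq_chartRicci]
  exact (ricci_warpedMetric g₁ g₂ hlam hpos x y _ _).trans h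

/-- `Ric((0, v), (0, w)) = Ric₂(v, w) - (lam Δ lam + (m₂ - 1) |grad lam|²) g₂(v, w)` for a warped
product. -/
theorem ricci_warpedMetric_inr (g₁ : RiemMetric I₁ M₁) (g₂ : RiemMetric I₂ M₂)
    {lam : M₁ → ℝ} (hlam : ContMDiff I₁ 𝓘(ℝ, ℝ) ∞ lam) (hpos : ∀ x, 0 < lam x)
    (x : M₁) (y : M₂)
    (v w : TangentSpace I₂ y) :
    ricci (warpedMetric g₁ g₂ lam hlam hpos) (x, y) ((0, v) : E₁ × E₂) ((0, w) : E₁ × E₂) =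
      ricci g₂ y v w - (lam x * laplacian g₁ lam x
        + (Module.finrank ℝ E₂ - 1) * gradNormSq g₁ lam x) * g₂.inner y v w := by
  have h0 : (lam ∘ (extChartAt I₁ x).symm) (extChartAt I₁ x x) = lam x :=
    congrArg lam (extChartAt_to_inv x)
  have h := (isWarpedAt_chartMetric g₁ g₂ hlam hpos x y).chartRicci_fiber v w
  rw [h0, chartMetric_self] at h
  rw [laplacian_eq_chartLaplacian, gradNormSq_eq g₁ ((hlam x).mdifferentiableAt (by simp)),
    ricci_eq_chartRicci g₂]
  exact (ricci_warpedMetric g₁ g₂ hlam hpos x y _ _).trans h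

end WarpedManifold

end WarpedFlow

end

/-! ### The evolution equations -/

theorem proposition5p1
    {E₁ : Type*} [NormedAddCommGroup E₁] [NormedSpace ℝ E₁] [FiniteDimensional ℝ E₁]
    {H₁ : Type*} [TopologicalSpace H₁] {I₁ : ModelWithCorners ℝ E₁ H₁} [I₁.Boundaryless]
    {M₁ : Type*} [TopologicalSpace M₁] [ChartedSpace H₁ M₁] [IsManifold I₁ ∞ M₁]
    {E₂ : Type*} [NormedAddCommGroup E₂] [NormedSpace ℝ E₂] [FiniteDimensional ℝ E₂]
    {H₂ : Type*} [TopologicalSpace H₂] {I₂ : ModelWithCorners ℝ E₂ H₂} [I₂.Boundaryless]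
    {M₂ : Type*} [TopologicalSpace M₂] [ChartedSpace H₂ M₂] [IsManifold I₂ ∞ M₂] [Nonempty M₂]
    (T : EReal) (g₁ : ℝ → RiemMetric I₁ M₁) (g₂ : ℝ → RiemMetric I₂ M₂) (lam : ℝ → M₁ → ℝ)
    (hlam : ∀ t, ContMDiff I₁ 𝓘(ℝ, ℝ) ∞ (lam t)) (hpos : ∀ t x, 0 < lam t x)
    (hflow : IsRicciFlow (fun t => warpedMetric (g₁ t) (g₂ t) (lam t) (hlam t) (hpos t)) T) :
    (∀ t ∈ timeInterval T, ∀ (x : M₁) (v w : TangentSpace I₁ x),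
      HasDerivWithinAt (fun s => (g₁ s).inner x v w)
        (-2 * ricci (g₁ t) x v w
          + 2 * (Module.finrank ℝ E₂ : ℝ) / lam t x * hessian (g₁ t) (lam t) x v w)
        (timeInterval T) t) ∧
    (∀ t ∈ timeInterval T, ∀ (x : M₁) (y : M₂) (v w : TangentSpace I₂ y),
      HasDerivWithinAt (fun s => lam s x ^ 2 * (g₂ s).inner y v w)
        (-2 * ricci (g₂ t) y v w
          + (laplacian (g₁ t) (fun x' => lam t x' ^ 2) x
              + (2 * (Module.finrank ℝ E₂ : ℝ) - 4) * gradNormSq (g₁ t) (lam t) x)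
            * (g₂ t).inner y v w)
        (timeInterval T) t) ∧
    (∀ (h : RiemMetric I₂ M₂) (c : ℝ), 1 ≤ Module.finrank ℝ E₂ → (∀ t ∈ timeInterval T, g₂ t = h) →
      (∀ (y : M₂) (v w : TangentSpace I₂ y), ricci h y v w = c * h.inner y v w) →
      ∀ t ∈ timeInterval T, ∀ x : M₁,
        HasDerivWithinAt (fun s => lam s x ^ 2)
          (-2 * c + laplacian (g₁ t) (fun x' => lam t x' ^ 2) x
            + (2 * (Module.finrank ℝ E₂ : ℝ) - 4) * gradNormSq (g₁ t) (lam t) x)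
          (timeInterval T) t) := by
  have hfib : ∀ t ∈ timeInterval T, ∀ (x : M₁) (y : M₂) (v w : TangentSpace I₂ y),
      HasDerivWithinAt (fun s => lam s x ^ 2 * (g₂ s).inner y v w)
        (-2 * ricci (g₂ t) y v w
          + (laplacian (g₁ t) (fun x' => lam t x' ^ 2) x
              + (2 * (Module.finrank ℝ E₂ : ℝ) - 4) * gradNormSq (g₁ t) (lam t) x)
            * (g₂ t).inner y v w)
        (timeInterval T) t := by
    intro t ht x y v w
    have h := hflow t ht (x, y) ((0, v) : E₁ × E₂) ((0, w) : E₁ × E₂)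
    simp only [warpedMetric_inner_inr, ricci_warpedMetric_inr] at h
    refine h.congr_deriv ?_
    rw [laplacian_sq (g₁ t) (hlam t)]
    ring
  refine ⟨?_, hfib, ?_⟩
  · intro t ht x v w
    obtain ⟨y⟩ := ‹Nonempty M₂›
    have h := hflow t ht (x, y) ((v, 0) : E₁ × E₂) ((w, 0) : E₁ × E₂)
    simp only [warpedMetric_inner_inl, ricci_warpedMetric_inl] at h
    refine h.congr_deriv ?_
    ring
  · intro h c hdim hconst hric t ht x
    obtain ⟨y⟩ := ‹Nonempty M₂›
    have : Nontrivial E₂ := Module.finrank_pos_iff.1 hdim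
    obtain ⟨v, hv⟩ : ∃ v : TangentSpace I₂ y, v ≠ 0 := exists_ne (0 : E₂)
    have hvv : h.inner y v v ≠ 0 := (h.pos y v hv).ne'
    -- divide the equation for `lam² g₂` by the constant `h(v, v)`
    have hd := (hfib t ht x y v v).div_const (h.inner y v v)
    rw [hconst t ht, hric] at hd
    refine (hd.congr_of_mem (fun s hs => ?_) ht).congr_deriv ?_
    · rw [hconst s hs, mul_div_cancel_right₀ _ hvv]
    · field_simp
      ring
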